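/- Call a profinite group $G$ *profinite-$C$* if every closed subgroup $H$ of $G$ has a closed permutable complement, i.e. there is a closed subgroup $K$ of $G$ with $G=HK$ and $H\cap K=1$. A profinite group $P$ is the *internal cartesian product* of a (possibly empty) family $(H_i)_{i\in I}$ of its subgroups, written $P=\mathrm{Cr}_{i\in I}\,H_i$, if every $H_i$ is closed and normal in $P$, $P=\overline{\langle H_i\mid i\in I\rangle}$, and $\bigcap_{i\in I}\overline{\langle H_j\mid j\neq i\rangle}=1$. **Theorem B.** Let $G$ be a profinite group. Then the following are equivalent: 1. $G$ is profinite-$C$. 2. $G=B\ltimes A$ is the internal semidirect product of closed subgroups $B$ and $A$ of $G$ (so $A$ is normal in $G$, $G=BA$ and $B\cap A=1$), where $B=\mathrm{Cr}_{j\in J}\,\langle b_j\rangle$ and $A=\mathrm{Cr}_{i\in I}\,\langle a_i\rangle$ for some families of elements $b_j\in B$ and $a_i\in A$, all $b_j$ and $a_i$ have prime order, and $\langle a_i\rangle\trianglelefteq G$ for every $i\in I$. Furthermore, if these properties hold, then in (2) one can choose $A=\overline{G'}$, the topological closure of the derived subgroup $G'$ of $G$ (for a suitable $B$). -/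

import Mathlib

/-- A (profinite) group `G` is profinite-`C` if every closed subgroup `H` has a closed permutable
complement `K`, that is, `G = H K` and `H ∩ K = 1`. For subgroups, `H.IsComplement' K` (every
element of `G` is uniquely of the form `h * k`) is the same as `H K = G` together with
`H ∩ K = 1`. -/
def IsProfiniteC (G : Type*) [Group G] [TopologicalSpace G] : Prop :=
  ∀ H : Subgroup G, IsClosed (H : Set G) →
    ∃ K : Subgroup G, IsClosed (K : Set G) ∧ H.IsComplement' K

/-- The (profinite) group `G` is the internal cartesian product of the family `H` of subgroups. -/
structure IsInternalCartesianProduct {G : Type*} [Group G] [TopologicalSpace G]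
    [IsTopologicalGroup G] {ι : Type*} (H : ι → Subgroup G) : Prop where
  /-- Every member of the family is normal. -/
  normal : ∀ i, (H i).Normal
  /-- Every member of the family is closed. -/
  isClosed : ∀ i, IsClosed (H i : Set G)
  /-- The family generates `G` topologically. -/
  topologicalClosure_eq_top : (⨆ i, H i).topologicalClosure = ⊤
  /-- The closed subgroups generated by all members but one intersect trivially. -/
  iInf_eq_bot : ⨅ i, (⨆ j, ⨆ _ : j ≠ i, H j).topologicalClosure = ⊥

/-- `G = B ⋉ A` is the internal semidirect product of a closed subgroup `B` and a closed normal
subgroup `A`, where `B` is the internal cartesian product of subgroups `⟨b j⟩`, `A` is the internal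
cartesian product of subgroups `⟨a i⟩`, all `b j` and `a i` have prime order, and every `⟨a i⟩` is
normal in `G`. (Distinct indices give distinct subgroups, so indexing by types in the universe of
`G` is no restriction.) -/
structure IsPrimeCyclicDecomposition.{u} {G : Type u} [Group G] [TopologicalSpace G]
    [IsTopologicalGroup G] (B A : Subgroup G) : Prop where
  isClosed_left : IsClosed (B : Set G)
  isClosed_right : IsClosed (A : Set G)
  normal_right : A.Normal
  isComplement' : B.IsComplement' A
  left_eq_prod : ∃ (J : Type u) (b : J → B),
    (∀ j, (orderOf (b j)).Prime) ∧
    IsInternalCartesianProduct fun j => Subgroup.zpowers (b j)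
  right_eq_prod : ∃ (I : Type u) (a : I → A),
    (∀ i, (orderOf (a i)).Prime) ∧
    (∀ i, (Subgroup.zpowers (a i : G)).Normal) ∧
    IsInternalCartesianProduct fun i => Subgroup.zpowers (a i)

/-!
Profinite groups in which every closed subgroup has a closed permutable complement.

*From complements to the decomposition.* Complements pass to closed subgroups and to quotients, so
the finite quotients are complemented in the sense of P. Hall. A finite complemented group is
soluble, since a complement of a subgroup of the least possible prime order is normal; its Frattini
subgroup is trivial, since a complement of it would be everything; and its abelian minimal normal
subgroups have prime order. Hence a faithful primitive complemented group is `⟨v⟩ ⋊ M` with `v` of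
prime order and `M` acting faithfully on `⟨v⟩`, and its derived subgroup lies in `⟨v⟩`
(`IsComplementedGroup.exists_prime_of_normalCore_eq_bot`). For the profinite group `G` this says
that the open maximal subgroups intersect trivially, have prime index, and that the normal core of
each of them either contains the closed derived subgroup `A` or meets it in a subgroup of prime
index. So the open subgroups of `A` that are normal in `G` and have prime index in `A` intersect
trivially. A maximal irredundant family of these behaves like a basis of a dual space, and the dual
basis consists of subgroups of prime order, normal in `G`, with cartesian product `A`
(`exists_isInternalCartesianProduct`). A complement `B` of `A` is abelian and is treated by the same
lemma.

*From the decomposition to complements.* Suppose that a family of closed normal maximal subgroups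
intersects trivially. A closed supplement of a closed subgroup `D` that is minimal among the
intersection-stable family under consideration must be a complement of `D`
(`exists_isComplement'_of_coatoms`). For `G = B ⋉ A` this yields a complement `C` of `A ∩ H` in `A`
that is normal in `G` and a complement `B₁` of `B ∩ AH` in `B`; then `C B₁` is a complement of `H`.
-/

section

open Subgroup
open scoped commutatorElement

/-! ### Complements and normality in abstract groups -/

namespace Subgroup

variable {G : Type*} [Group G]

theorem isComplement'_iff_disjoint_and_exists {H K : Subgroup G} :
    H.IsComplement' K ↔ Disjoint H K ∧ ∀ x, ∃ h ∈ H, h⁻¹ * x ∈ K := by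
  constructor
  · refine fun h => ⟨h.disjoint, fun x => ?_⟩
    obtain ⟨y, hy, z, hz, rfl⟩ := Set.mem_mul.1 (h.mul_eq.symm ▸ Set.mem_univ x)
    exact ⟨y, hy, by simpa using hz⟩
  · rintro ⟨h, h'⟩
    refine isComplement'_of_disjoint_and_mul_eq_univ h (Set.eq_univ_of_forall fun x => ?_)
    obtain ⟨y, hy, hx⟩ := h' x
    exact ⟨y, hy, y⁻¹ * x, hx, by simp⟩

/-- The modular law: a complement of `H ≤ L` in `G` cuts out a complement of `H` in `L`. -/
theorem IsComplement'.subgroupOf_right {L : Subgroup G} {H : Subgroup L} {K : Subgroup G}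
    (h : (H.map L.subtype).IsComplement' K) : H.IsComplement' (K.subgroupOf L) := by
  rw [isComplement'_iff_disjoint_and_exists, disjoint_def] at h ⊢
  refine ⟨fun {x} hx hx' => Subtype.ext (h.1 (mem_map_of_mem _ hx) hx'), fun x => ?_⟩
  obtain ⟨_, ⟨y, hy, rfl⟩, hx⟩ := h.2 x
  exact ⟨y, hy, hx⟩

theorem IsComplement'.map_of_comap {G' : Type*} [Group G'] {f : G →* G'}
    (hf : Function.Surjective f) {H : Subgroup G'} {K : Subgroup G}
    (h : (H.comap f).IsComplement' K) : H.IsComplement' (K.map f) := by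
  rw [isComplement'_iff_disjoint_and_exists, disjoint_def] at h ⊢
  refine ⟨?_, fun x => ?_⟩
  · rintro _ hx ⟨y, hy, rfl⟩
    rw [h.1 hx hy, map_one]
  · obtain ⟨x, rfl⟩ := hf x
    obtain ⟨y, hy, hx⟩ := h.2 x
    exact ⟨f y, hy, _, hx, by simp⟩

theorem isCoatom_of_index_prime {M : Subgroup G} (h : M.index.Prime) : IsCoatom M := by
  refine ⟨fun hM => h.ne_one (index_eq_one.2 hM), fun L hL => ?_⟩
  have hdvd := relIndex_mul_index hL.le
  rcases (Nat.prime_mul_iff.1 (hdvd.symm ▸ h)) with ⟨-, h1⟩ | ⟨-, h1⟩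
  · exact index_eq_one.1 h1
  · exact absurd (relIndex_eq_one.1 h1) hL.not_ge

theorem zpowers_le_of_mem_of_ne_one {a b : G} (ha : (orderOf a).Prime) {L : Subgroup G}
    (hb : b ∈ zpowers a) (hb1 : b ≠ 1) (hbL : b ∈ L) : zpowers a ≤ L := by
  have : Fact (orderOf a).Prime := ⟨ha⟩
  have hcard : Nat.card (zpowers a) = orderOf a := Nat.card_zpowers a
  intro c hc
  have hne : (⟨b, hb⟩ : zpowers a) ≠ 1 := fun h => hb1 (congrArg Subtype.val h)
  obtain ⟨n, hn⟩ := mem_zpowers_of_prime_card hcard hne (g' := ⟨c, hc⟩)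
  have : b ^ n = c := congrArg Subtype.val hn
  exact this ▸ zpow_mem hbL n

/-- A subgroup normalized by two subgroups that generate the group is normal. -/
theorem normal_of_sup_eq_top {H K L : Subgroup G} (h : H ⊔ K = ⊤)
    (hH : ∀ g ∈ H, ∀ x ∈ L, g * x * g⁻¹ ∈ L) (hK : ∀ g ∈ K, ∀ x ∈ L, g * x * g⁻¹ ∈ L) :
    L.Normal := by
  have key : ∀ {S : Subgroup G}, (∀ g ∈ S, ∀ x ∈ L, g * x * g⁻¹ ∈ L) → S ≤ normalizer L := by
    refine fun {S} hS g hg => mem_normalizer_iff.2 fun x => ⟨hS g hg x, fun hx => ?_⟩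
    have := hS g⁻¹ (inv_mem hg) _ hx
    simpa [mul_assoc] using this
  exact normalizer_eq_top_iff.1 (top_le_iff.1 (h ▸ sup_le (key hH) (key hK)))

/-- Automorphisms of a cyclic group commute, so commutators centralize every normal cyclic
subgroup. -/
theorem commutator_le_centralizer_zpowers {v : G} (hv : (zpowers v).Normal) :
    _root_.commutator G ≤ centralizer {v} := by
  have key : ∀ g k : G, g * k * v * (g * k)⁻¹ = k * g * v * (k * g)⁻¹ := fun g k => by
    obtain ⟨m, hm⟩ := mem_zpowers_iff.1 (hv.conj_mem v (mem_zpowers v) g)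
    obtain ⟨n, hn⟩ := mem_zpowers_iff.1 (hv.conj_mem v (mem_zpowers v) k)
    have h1 : g * k * v * (g * k)⁻¹ = g * (k * v * k⁻¹) * g⁻¹ := by group
    have h2 : k * g * v * (k * g)⁻¹ = k * (g * v * g⁻¹) * k⁻¹ := by group
    rw [h1, h2, ← hm, ← hn, ← conj_zpow, ← conj_zpow, ← hm, ← hn, ← zpow_mul, ← zpow_mul, mul_comm]
  rw [commutator_eq_closure, closure_le]
  rintro _ ⟨g, k, rfl⟩
  have h1 : ⁅g, k⁆ * v * ⁅g, k⁆⁻¹ = g * k * (g⁻¹ * k⁻¹ * v * (g⁻¹ * k⁻¹)⁻¹) * (g * k)⁻¹ := by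
    rw [commutatorElement_def]; group
  rw [key g⁻¹ k⁻¹] at h1
  have h2 : ⁅g, k⁆ * v * ⁅g, k⁆⁻¹ = v := by rw [h1]; group
  exact mem_centralizer_singleton_iff.2 (mul_inv_eq_iff_eq_mul.1 h2)

end Subgroup


/-! ### Finite complemented groups -/

/-- Every subgroup has a permutable complement. For finite groups these are P. Hall's
complemented groups. -/
def IsComplementedGroup (G : Type*) [Group G] : Prop :=
  ∀ H : Subgroup G, ∃ K : Subgroup G, H.IsComplement' K

namespace IsComplementedGroup

variable {G : Type*} [Group G]

theorem subgroup (h : IsComplementedGroup G) (L : Subgroup G) : IsComplementedGroup L :=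
  fun H => (h (H.map L.subtype)).imp' (fun K => K.subgroupOf L) fun _ hK => hK.subgroupOf_right

/-- The Frattini subgroup has a complement, which must be everything: it consists of
non-generators. -/
theorem frattini_eq_bot [Finite G] (h : IsComplementedGroup G) : frattini G = ⊥ := by
  obtain ⟨K, hK⟩ := h (frattini G)
  have : K = ⊤ := frattini_nongenerating (hK.symm.sup_eq_top)
  rwa [this, isComplement'_top_right] at hK

/-- For the least prime `p` dividing the order, a complement of a subgroup of order `p` has index
`p` and is therefore normal; induct on the order. -/
theorem isSolvable [Finite G] (h : IsComplementedGroup G) : Group.IsSolvable G := by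
  induction hn : Nat.card G using Nat.strong_induction_on generalizing G with
  | _ n ih =>
    rcases subsingleton_or_nontrivial G with hG | hG
    · infer_instance
    have hp : (Nat.card G).minFac.Prime := Nat.minFac_prime (Finite.one_lt_card.ne')
    have : Fact (Nat.card G).minFac.Prime := ⟨hp⟩
    obtain ⟨x, hx⟩ := exists_prime_orderOf_dvd_card' (G := G) _ (Nat.minFac_dvd _)
    obtain ⟨K, hK⟩ := h (zpowers x)
    have hindex : K.index = (Nat.card G).minFac := by
      rw [hK.index_eq_card, Nat.card_zpowers, hx]
    have : K.Normal := normal_of_index_eq_minFac_card hindex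
    have hlt : Nat.card K < n := by
      rw [← hn, ← K.card_mul_index, hindex]
      exact lt_mul_of_one_lt_right Nat.card_pos hp.one_lt
    have hK' : Group.IsSolvable K := ih _ hlt (h.subgroup K) rfl
    have : IsCyclic (G ⧸ K) := isCyclic_of_prime_card (p := (Nat.card G).minFac) hindex
    have : Group.IsSolvable (G ⧸ K) := by
      let _ : CommGroup (G ⧸ K) := IsCyclic.commGroup
      exact Group.isSolvable_of_comm mul_comm
    exact (Group.isSolvable_iff_subgroup_quotient K).2 ⟨hK', this⟩

/-- Let `v ∈ V` have prime order and let `K₁` be a complement of `⟨v⟩`, so that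
`V = ⟨v⟩ (K₁ ∩ V)`. A complement `K₂` of `K₁ ∩ V` meets the abelian group `V` in a normal subgroup
of the whole group, so by minimality `V ≤ K₂` and `K₁ ∩ V` is trivial. -/
theorem exists_zpowers_eq_of_minimal [Finite G] (h : IsComplementedGroup G) {V : Subgroup G}
    (hV : Minimal (fun V : Subgroup G => V.Normal ∧ V ≠ ⊥) V)
    (hcomm : ∀ a ∈ V, ∀ b ∈ V, a * b = b * a) :
    ∃ v, (orderOf v).Prime ∧ zpowers v = V := by
  have hVn : V.Normal := hV.prop.1
  have hcard : Nat.card V ≠ 1 := fun hc => hV.prop.2 (V.card_eq_one.1 hc)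
  have : Fact (Nat.card V).minFac.Prime := ⟨Nat.minFac_prime hcard⟩
  obtain ⟨⟨v, hvV⟩, hv⟩ := exists_prime_orderOf_dvd_card' (G := V) _ (Nat.minFac_dvd _)
  rw [orderOf_mk] at hv
  have hprime : (orderOf v).Prime := hv ▸ Nat.minFac_prime hcard
  have hle : zpowers v ≤ V := zpowers_le.2 hvV
  refine ⟨v, hprime, le_antisymm hle ?_⟩
  obtain ⟨K₁, hK₁⟩ := h (zpowers v)
  obtain ⟨K₂, hK₂⟩ := h (K₁ ⊓ V)
  rw [isComplement'_iff_disjoint_and_exists, disjoint_def] at hK₁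
  have hsup : K₂ ⊔ V = ⊤ :=
    top_le_iff.1 (hK₂.sup_eq_top ▸ sup_le (inf_le_right.trans le_sup_right) le_sup_left)
  have hnormal : (K₂ ⊓ V).Normal := by
    refine normal_of_sup_eq_top hsup (fun g hg x hx => ?_) fun g hg x hx => ?_
    · exact ⟨K₂.mul_mem (K₂.mul_mem hg hx.1) (K₂.inv_mem hg), hVn.conj_mem x hx.2 g⟩
    · rwa [hcomm g hg x hx.2, mul_inv_cancel_right]
  rw [isComplement'_iff_disjoint_and_exists, disjoint_def] at hK₂
  have hVK₂ : V ≤ K₂ := by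
    by_contra hnot
    have hbot : K₂ ⊓ V = ⊥ := by
      by_contra hne
      exact hnot ((hV.le_of_le ⟨hnormal, hne⟩ inf_le_right).trans inf_le_left)
    obtain ⟨w, hw, hwv⟩ := hK₂.2 v
    have : w⁻¹ * v ∈ K₂ ⊓ V := ⟨hwv, V.mul_mem (V.inv_mem hw.2) hvV⟩
    rw [hbot, mem_bot, inv_mul_eq_one] at this
    have hv1 := hK₁.1 (mem_zpowers v) (this ▸ hw.1)
    exact hprime.ne_one (orderOf_eq_one_iff.2 hv1)
  intro x hx
  obtain ⟨y, hy, hyx⟩ := hK₁.2 x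
  have hyxV : y⁻¹ * x ∈ V := mul_mem (inv_mem (hle hy)) hx
  rw [← inv_mul_eq_one.1 (hK₂.1 ⟨hyx, hyxV⟩ (hVK₂ hyxV))]
  exact hy

/-- A finite complemented group with a core-free maximal subgroup `M` (a faithful primitive
group) is a semidirect product of a group `⟨v⟩` of prime order with a group of automorphisms of
`⟨v⟩`. In particular its derived subgroup lies in `⟨v⟩`. -/
theorem exists_prime_of_normalCore_eq_bot [Finite G] (h : IsComplementedGroup G) {M : Subgroup G}
    (hM : IsCoatom M) (hcore : M.normalCore = ⊥) :
    ∃ v : G, (orderOf v).Prime ∧ (zpowers v).IsComplement' M ∧ commutator G ≤ zpowers v := by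
  have hsol := h.isSolvable
  have htop : (⊤ : Subgroup G) ≠ ⊥ := fun htop => hM.1 (top_le_iff.1 (htop ▸ bot_le))
  obtain ⟨V, -, hV⟩ := (Set.toFinite {V : Subgroup G | V.Normal ∧ V ≠ ⊥}).exists_le_minimal
    (a := ⊤) ⟨inferInstance, htop⟩
  have hVn : V.Normal := hV.prop.1
  have hbot : ⁅V, V⁆ = ⊥ := by
    by_contra hne
    exact hV.not_lt ⟨inferInstance, hne⟩ (Group.IsSolvable.commutator_lt_of_ne_bot hV.prop.2)
  have hcomm : ∀ a ∈ V, ∀ b ∈ V, a * b = b * a := fun a ha b hb =>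
    commutatorElement_eq_one_iff_mul_comm.1 (mem_bot.1 (hbot ▸ commutator_mem_commutator ha hb))
  obtain ⟨v, hv, hvV⟩ := h.exists_zpowers_eq_of_minimal hV hcomm
  have hcore' : ∀ N : Subgroup G, N.Normal → N ≤ M → N = ⊥ := fun N _ hN =>
    le_bot_iff.1 (hcore ▸ normal_le_normalCore.2 hN)
  have hsup : V ⊔ M = ⊤ := hM.2 _ (right_lt_sup.2 fun hle => hV.prop.2 (hcore' _ hVn hle))
  have hdecomp : ∀ x, ∃ y ∈ V, y⁻¹ * x ∈ M := fun x => by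
    obtain ⟨y, hy, z, hz, rfl⟩ := mem_sup_of_normal_left.1 (hsup.symm ▸ mem_top x)
    exact ⟨y, hy, by simpa using hz⟩
  have hC : (centralizer (V : Set G)).Normal := inferInstance
  have hVC : V ≤ centralizer (V : Set G) := fun a ha =>
    mem_centralizer_iff.2 fun b hb => hcomm b hb a ha
  have hMC : centralizer (V : Set G) ⊓ M = ⊥ := by
    refine hcore' _ (normal_of_sup_eq_top hsup (fun g hg x hx => ?_) fun g hg x hx => ?_)
      inf_le_right
    · rwa [mem_centralizer_iff.1 hx.1 g hg, mul_inv_cancel_right]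
    · exact ⟨hC.conj_mem x hx.1 g, M.mul_mem (M.mul_mem hg hx.2) (M.inv_mem hg)⟩
  have hCV : centralizer (V : Set G) ≤ V := fun x hx => by
    obtain ⟨y, hy, hyx⟩ := hdecomp x
    have : y⁻¹ * x ∈ centralizer (V : Set G) ⊓ M :=
      ⟨Subgroup.mul_mem _ (Subgroup.inv_mem _ (hVC hy)) hx, hyx⟩
    rw [hMC, mem_bot, inv_mul_eq_one] at this
    exact this ▸ hy
  refine ⟨v, hv, ?_, ?_⟩ <;> rw [hvV]
  · exact isComplement'_iff_disjoint_and_exists.2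
      ⟨disjoint_iff_inf_le.2 (hMC ▸ inf_le_inf_right M hVC), hdecomp⟩
  · refine (commutator_le_centralizer_zpowers (hvV ▸ hVn)).trans (le_trans (fun x hx => ?_) hCV)
    rw [← hvV]
    refine mem_centralizer_iff.2 fun b hb => ?_
    obtain ⟨n, rfl⟩ := mem_zpowers_iff.1 hb
    have hxv : Commute x v := mem_centralizer_singleton_iff.1 hx
    exact (hxv.symm.zpow_left n).eq

/-- A maximal subgroup with a complemented finite quotient by its normal core has prime index, and
the derived group of the quotient lies in a subgroup of that order. -/
theorem exists_card_eq_index {Q : Type*} [Group Q] [Finite Q] (h : IsComplementedGroup Q)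
    {M : Subgroup G} (hM : IsCoatom M) {f : G →* Q} (hf : Function.Surjective f)
    (hker : f.ker = M.normalCore) :
    ∃ V : Subgroup Q, Nat.card V = M.index ∧ M.index.Prime ∧ commutator G ≤ V.comap f := by
  have hcomap : (M.map f).comap f = M := by
    rw [comap_map_eq, hker, sup_eq_left]
    exact M.normalCore_le
  have hM' : IsCoatom (M.map f) := by
    refine ⟨fun htop => hM.1 (by rw [← hcomap, htop, comap_top]), fun L hL => ?_⟩
    have hlt : M < L.comap f := hcomap.symm.trans_lt ((comap_lt_comap_of_surjective hf).2 hL)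
    rw [← map_comap_eq_self_of_surjective hf L, hM.2 _ hlt, map_top_of_surjective f hf]
  have hcore : (M.map f).normalCore = ⊥ := by
    have hle : (M.map f).normalCore.comap f ≤ M.normalCore :=
      normal_le_normalCore.2 ((comap_mono (normalCore_le _)).trans hcomap.le)
    rw [← map_comap_eq_self_of_surjective hf (M.map f).normalCore, Subgroup.map_eq_bot_iff, hker]
    exact hle
  obtain ⟨v, hv, hcompl, hcomm⟩ := h.exists_prime_of_normalCore_eq_bot hM' hcore
  have hindex : M.index = orderOf v := by
    rw [← hcomap, index_comap_of_surjective _ hf, hcompl.index_eq_card, Nat.card_zpowers]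
  refine ⟨zpowers v, hindex ▸ Nat.card_zpowers v, hindex ▸ hv, ?_⟩
  rw [← map_le_iff_le_comap, _root_.commutator_def, map_commutator, map_top_of_surjective f hf]
  exact hcomm

end IsComplementedGroup

/-! ### Minimal closed supplements -/

section Supplements

variable {P : Type*} [Group P] [TopologicalSpace P]

/-- If `K` is a minimal closed supplement of `D` and `(D ∩ K) N` is the whole group, then `K ∩ N` is
still a supplement of `D`, whence `K ≤ N`. -/
theorem Minimal.le_of_sup_eq_top {Q : Set (Subgroup P)} (hQ : ∀ S ⊆ Q, sInf S ∈ Q)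
    {D K N : Subgroup P} (hK : Minimal (fun K : Subgroup P =>
      K ∈ Q ∧ IsClosed (K : Set P) ∧ ∀ x, ∃ d ∈ D, d⁻¹ * x ∈ K) K)
    (hNQ : N ∈ Q) (hNc : IsClosed (N : Set P)) (hN : N.Normal) (h : D ⊓ K ⊔ N = ⊤) : K ≤ N := by
  refine (hK.le_of_le ⟨?_, ?_, fun x => ?_⟩ (inf_le_left : K ⊓ N ≤ K)).trans inf_le_right
  · rw [← sInf_pair]
    exact hQ _ (Set.pair_subset hK.prop.1 hNQ)
  · exact hK.prop.2.1.inter hNc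
  · obtain ⟨d, hd, hx⟩ := hK.prop.2.2 x
    obtain ⟨y, hy, z, hz, hyz⟩ := mem_sup_of_normal_right.1 (h.symm ▸ mem_top (d⁻¹ * x))
    have hz' : (d * y)⁻¹ * x = z := by rw [mul_inv_rev, mul_assoc, ← hyz]; simp
    refine ⟨d * y, D.mul_mem hd hy.1, hz' ▸ ⟨?_, hz⟩⟩
    have : z = y⁻¹ * (d⁻¹ * x) := by rw [← hyz]; simp
    exact this ▸ K.mul_mem (K.inv_mem hy.2) hx

variable [IsTopologicalGroup P] [CompactSpace P]

/-- By compactness, every closed subgroup `D` has a supplement that is minimal among the closed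
supplements in a family of subgroups stable under intersections. -/
theorem exists_minimal_closed_supplement {Q : Set (Subgroup P)} (hQ : ∀ S ⊆ Q, sInf S ∈ Q)
    {D : Subgroup P} (hD : IsClosed (D : Set P)) :
    ∃ K, Minimal (fun K : Subgroup P =>
      K ∈ Q ∧ IsClosed (K : Set P) ∧ ∀ x, ∃ d ∈ D, d⁻¹ * x ∈ K) K := by
  refine zorn_le₀ (α := (Subgroup P)ᵒᵈ) {K : Subgroup P |
      K ∈ Q ∧ IsClosed (K : Set P) ∧ ∀ x, ∃ d ∈ D, d⁻¹ * x ∈ K} fun c hc hchain => ?_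
  let c' : Set (Subgroup P) := c
  refine ⟨(sInf c' : Subgroup P), ⟨hQ _ fun K hK => (hc hK).1, ?_, fun x => ?_⟩,
    fun K hK => (sInf_le hK : sInf c' ≤ K)⟩
  · rw [coe_sInf]
    exact isClosed_biInter fun K hK => (hc hK).2.1
  · have hcl : ∀ K ∈ c', IsClosed {d | d⁻¹ * x ∈ K} := fun K hK =>
      (hc hK).2.1.preimage (continuous_inv.mul continuous_const)
    obtain ⟨d, hd, hdK⟩ := hD.isCompact.nonempty_inter_sInter
      (t := (fun K : Subgroup P => {d | d⁻¹ * x ∈ K}) '' c') (by simpa using hcl) (by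
        intro a ha hfin
        obtain ⟨b, hb, hbfin, rfl⟩ := Set.exists_subset_image_finite_and.1 ⟨a, ha, hfin, rfl⟩
        rcases b.eq_empty_or_nonempty with rfl | hbne
        · exact ⟨1, D.one_mem, by simp⟩
        -- The finite chain `b` has a least member.
        obtain ⟨K, hK⟩ := hbfin.exists_minimal hbne
        obtain ⟨d, hd, hdx⟩ := (hc (hb hK.prop)).2.2 x
        refine ⟨d, hd, Set.mem_sInter.2 ?_⟩
        rintro _ ⟨L, hL, rfl⟩
        have hKL : K ≤ L := (hchain.total (hb hK.prop) (hb hL)).elim (hK.le_of_le hL) id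
        exact hKL hdx)
    refine ⟨d, hd, mem_sInf.2 fun K hK => ?_⟩
    exact hdK _ (Set.mem_image_of_mem _ hK)

/-- Let `Q` be stable under intersections and contain closed normal maximal subgroups with
trivial intersection. Then every closed subgroup `D` has a closed complement in `Q`: a minimal
closed supplement `K` in `Q` works, because if `D ∩ K` were not contained in some maximal `N i`
then `K ∩ N i` would still be a supplement. -/
theorem exists_isComplement'_of_coatoms {Q : Set (Subgroup P)} (hQ : ∀ S ⊆ Q, sInf S ∈ Q)
    {ι : Type*} {N : ι → Subgroup P} (hNQ : ∀ i, N i ∈ Q) (hNc : ∀ i, IsClosed (N i : Set P))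
    (hNn : ∀ i, (N i).Normal) (hNm : ∀ i, IsCoatom (N i)) (hN : ⨅ i, N i = ⊥)
    {D : Subgroup P} (hD : IsClosed (D : Set P)) :
    ∃ K ∈ Q, IsClosed (K : Set P) ∧ D.IsComplement' K := by
  obtain ⟨K, hK⟩ := exists_minimal_closed_supplement hQ hD
  refine ⟨K, hK.prop.1, hK.prop.2.1,
    isComplement'_iff_disjoint_and_exists.2 ⟨disjoint_iff_inf_le.2 ?_, hK.prop.2.2⟩⟩
  rw [← hN]
  refine le_iInf fun i => ?_
  by_contra hi
  exact hi (inf_le_right.trans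
    (hK.le_of_sup_eq_top hQ (hNQ i) (hNc i) (hNn i) ((hNm i).2 _ (right_lt_sup.2 hi))))

end Supplements

/-! ### Irredundant families of maximal subgroups -/

section Independence

variable {P : Type*} [Group P]

/-- A family of subgroups is irredundant if no member contains the intersection of the others. -/
def Irredundant (S : Set (Subgroup P)) : Prop :=
  ∀ M ∈ S, ¬ sInf (S \ {M}) ≤ M

variable [TopologicalSpace P] [CompactSpace P]

theorem exists_finite_sInf_le {S : Set (Subgroup P)} (hS : ∀ K ∈ S, IsClosed (K : Set P))
    {M : Subgroup P} (hM : IsOpen (M : Set P)) (h : sInf S ≤ M) :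
    ∃ F ⊆ S, F.Finite ∧ sInf F ≤ M := by
  by_contra! hF
  obtain ⟨x, hx, hxS⟩ := hM.isClosed_compl.isCompact.nonempty_inter_sInter
    (t := (fun K : Subgroup P => (K : Set P)) '' S) (by simpa using hS) (by
      intro a ha hfin
      obtain ⟨b, hb, hbfin, rfl⟩ := Set.exists_subset_image_finite_and.1 ⟨a, ha, hfin, rfl⟩
      obtain ⟨x, hx, hxM⟩ := SetLike.not_le_iff_exists.1 (hF b hb hbfin)
      exact ⟨x, hxM, by simpa [mem_sInf] using hx⟩)
  exact hx (h (mem_sInf.2 fun K hK => hxS _ (Set.mem_image_of_mem _ hK)))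

variable [IsTopologicalGroup P]

/-- A maximal irredundant subfamily of a family of open normal maximal subgroups has the same
intersection as the whole family, as in the exchange lemma for bases. -/
theorem exists_irredundant {S : Set (Subgroup P)} (ho : ∀ M ∈ S, IsOpen (M : Set P))
    (hn : ∀ M ∈ S, M.Normal) (hm : ∀ M ∈ S, IsCoatom M) :
    ∃ T ⊆ S, Irredundant T ∧ ∀ M ∈ S, sInf T ≤ M := by
  obtain ⟨T, hT⟩ := zorn_subset {T | T ⊆ S ∧ Irredundant T} (by
    intro c hc hchain
    refine ⟨⋃₀ c, ⟨Set.sUnion_subset fun T hT => (hc hT).1, fun M hM hle => ?_⟩,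
      fun T hT => Set.subset_sUnion_of_mem hT⟩
    obtain ⟨T, hTc, hMT⟩ := hM
    obtain ⟨F, hFc, hFfin, hF⟩ := exists_finite_sInf_le (fun K hK => by
      obtain ⟨⟨T', hT', hK'⟩, -⟩ := hK
      exact K.isClosed_of_isOpen (ho K ((hc hT').1 hK'))) (ho M ((hc hTc).1 hMT)) hle
    obtain ⟨T', hT'c, hFT'⟩ := hchain.directedOn.exists_mem_subset_of_finite_of_subset_sUnion
      ⟨T, hTc⟩ (hFfin.insert M) (Set.insert_subset ⟨T, hTc, hMT⟩ fun K hK => (hFc hK).1)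
    refine (hc hT'c).2 M (hFT' (Set.mem_insert _ _)) (le_trans (sInf_le_sInf fun K hK => ?_) hF)
    exact ⟨hFT' (Set.mem_insert_of_mem _ hK), (hFc hK).2⟩)
  refine ⟨T, hT.prop.1, hT.prop.2, fun M hM => ?_⟩
  by_contra hMT
  have hMnotin : M ∉ T := fun h => hMT (sInf_le h)
  have hnot : ¬ Irredundant (insert M T) := fun h => hMnotin
    (hT.le_of_ge ⟨Set.insert_subset hM hT.prop.1, h⟩ (Set.subset_insert M T)
      (Set.mem_insert M T))
  simp only [Irredundant, not_forall, not_not] at hnot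
  obtain ⟨M₀, hM₀, hle⟩ := hnot
  rcases Set.mem_insert_iff.1 hM₀ with rfl | hM₀T
  · rw [Set.insert_sdiff_self_of_notMem hMnotin] at hle
    exact hMT hle
  · have hne : M ≠ M₀ := fun h => hMnotin (h ▸ hM₀T)
    rw [Set.insert_sdiff_of_notMem _ (by simpa using hne), sInf_insert] at hle
    have hMn := hn M hM
    obtain ⟨e, he, heM₀⟩ := SetLike.not_le_iff_exists.1 (hT.prop.2 M₀ hM₀T)
    have hsup : sInf T ⊔ M = ⊤ := (hm M hM).2 _ (right_lt_sup.2 hMT)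
    obtain ⟨y, hy, z, hz, hyz⟩ := mem_sup_of_normal_right.1 (hsup.symm ▸ mem_top e)
    have hzE : z ∈ sInf (T \ {M₀}) := by
      rw [← inv_mul_eq_iff_eq_mul.2 hyz.symm]
      exact mul_mem (inv_mem (mem_sInf.2 fun K hK => mem_sInf.1 hy K hK.1)) he
    exact heM₀ (hyz ▸ M₀.mul_mem (mem_sInf.1 hy M₀ hM₀T) (hle ⟨hz, hzE⟩))

end Independence

/-! ### Cartesian products of groups of prime order -/

section CartesianProduct

universe u

variable {P : Type u} [Group P] [TopologicalSpace P] [IsTopologicalGroup P] [CompactSpace P]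
  [T2Space P]

/-- If `Q` is stable under intersections, consists of normal subgroups, and its open members of
prime index intersect trivially, then the group is a cartesian product of members of `Q` of prime
order. The factors are the intersections of all but one of the members of a maximal irredundant
family of open members of prime index. -/
theorem exists_isInternalCartesianProduct {Q : Set (Subgroup P)} (hQ : ∀ S ⊆ Q, sInf S ∈ Q)
    (hn : ∀ K ∈ Q, K.Normal)
    (hx : ∀ x : P, x ≠ 1 → ∃ M ∈ Q, IsOpen (M : Set P) ∧ M.index.Prime ∧ x ∉ M) :
    ∃ (I : Type u) (a : I → P), (∀ i, (orderOf (a i)).Prime) ∧ (∀ i, zpowers (a i) ∈ Q) ∧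
      IsInternalCartesianProduct fun i => zpowers (a i) := by
  obtain ⟨T, hTS, hT, hinf⟩ := exists_irredundant
    (S := {M : Subgroup P | M ∈ Q ∧ IsOpen (M : Set P) ∧ M.index.Prime}) (fun M hM => hM.2.1)
    (fun M hM => hn M hM.1) fun M hM => isCoatom_of_index_prime hM.2.2
  have hbot : sInf T = ⊥ := (eq_bot_iff_forall _).2 fun x hxT => by
    by_contra hx1
    obtain ⟨M, hMQ, hMo, hMi, hxM⟩ := hx x hx1
    exact hxM (hinf M ⟨hMQ, hMo, hMi⟩ hxT)
  have hL : ∀ M : T, sInf (T \ {M.1}) ∈ Q := fun M => hQ _ fun K hK => (hTS hK.1).1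
  have hcompl : ∀ M : T, (sInf (T \ {M.1})).IsComplement' M.1 := fun M => by
    have hsup : sInf (T \ {M.1}) ⊔ M.1 = ⊤ :=
      (isCoatom_of_index_prime (hTS M.2).2.2).2 _ (right_lt_sup.2 (hT M M.2))
    have := hn _ (hL M)
    refine isComplement'_iff_disjoint_and_exists.2 ⟨disjoint_iff_inf_le.2 ?_, fun x => ?_⟩
    · rw [← hbot, inf_comm, ← sInf_insert, Set.insert_sdiff_singleton, Set.insert_eq_of_mem M.2]
    · obtain ⟨y, hy, z, hz, rfl⟩ := mem_sup_of_normal_left.1 (hsup.symm ▸ mem_top x)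
      exact ⟨y, hy, by simpa using hz⟩
  have hgen : ∀ M : T, ∃ a : P, (orderOf a).Prime ∧ zpowers a = sInf (T \ {M.1}) := fun M => by
    have hcard : (Nat.card (sInf (T \ {M.1}) : Subgroup P)).Prime :=
      (hcompl M).index_eq_card ▸ (hTS M.2).2.2
    have : Fact (Nat.card (sInf (T \ {M.1}) : Subgroup P)).Prime := ⟨hcard⟩
    have : IsCyclic (sInf (T \ {M.1}) : Subgroup P) := isCyclic_of_prime_card rfl
    obtain ⟨a, ha⟩ := Subgroup.isCyclic_iff_exists_zpowers_eq_top _ |>.1 this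
    refine ⟨a, ?_, ha⟩
    rw [← Nat.card_zpowers, ha]
    exact hcard
  choose a ha hza using hgen
  have hle : ∀ M N : T, N ≠ M → zpowers (a N) ≤ M.1 := fun M N hMN => by
    rw [hza]
    exact sInf_le ⟨M.2, fun h => hMN (Subtype.ext (Set.mem_singleton_iff.1 h)).symm⟩
  refine ⟨T, a, ha, fun M => hza M ▸ hL M, ?_, ?_, ?_, ?_⟩
  · exact fun M => hn _ (hza M ▸ hL M)
  · intro M
    have : Finite (zpowers (a M)) := Nat.finite_of_card_ne_zero (by
      rw [Nat.card_zpowers]; exact (ha M).ne_zero)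
    exact (Set.toFinite (zpowers (a M) : Set P)).isClosed
  · set C := (⨆ M, zpowers (a M)).topologicalClosure with hC
    have hleC : ∀ M, zpowers (a M) ≤ C := fun M =>
      (le_iSup (fun M => zpowers (a M)) M).trans (le_topologicalClosure _)
    -- A minimal closed supplement of `C`, among the subgroups that for each `M` lie in `M` or
    -- contain the factor belonging to `M`, lies in every `M` and is therefore trivial.
    let R : Set (Subgroup P) := {K | ∀ M : T, K ≤ M.1 ∨ zpowers (a M) ≤ K}
    have hR : ∀ S ⊆ R, sInf S ∈ R := fun S hS M => by
      by_cases h : ∃ K ∈ S, K ≤ M.1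
      · obtain ⟨K, hK, hKM⟩ := h
        exact Or.inl ((sInf_le hK).trans hKM)
      · push Not at h
        exact Or.inr (le_sInf fun K hK => (hS hK M).resolve_left (h K hK))
    obtain ⟨K, hK⟩ := exists_minimal_closed_supplement hR (isClosed_topologicalClosure _ :
      IsClosed (C : Set P))
    have hKM : ∀ M : T, K ≤ M.1 := fun M => by
      by_contra hnot
      have hLK := (hK.prop.1 M).resolve_left hnot
      refine hnot (hK.le_of_sup_eq_top hR (fun N => ?_)
        (M.1.isClosed_of_isOpen (hTS M.2).2.1) (hn _ (hTS M.2).1)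
        (top_le_iff.1 ((hcompl M).sup_eq_top ▸ sup_le_sup_right ?_ _)))
      · rcases eq_or_ne N M with rfl | hNM
        · exact Or.inl le_rfl
        · exact Or.inr (hle M N hNM)
      · exact hza M ▸ le_inf (hleC M) hLK
    refine (eq_top_iff' _).2 fun x => ?_
    obtain ⟨d, hd, hdx⟩ := hK.prop.2.2 x
    have : d⁻¹ * x ∈ sInf T := mem_sInf.2 fun M hM => hKM ⟨M, hM⟩ hdx
    rw [hbot, mem_bot, inv_mul_eq_one] at this
    exact this ▸ hd
  · rw [eq_bot_iff, ← hbot]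
    refine le_sInf fun M hM => (iInf_le _ ⟨M, hM⟩).trans (topologicalClosure_minimal _ ?_
      (M.isClosed_of_isOpen (hTS hM).2.1))
    exact iSup₂_le fun N hN => hle ⟨M, hM⟩ N hN

/-- In a cartesian product of groups of prime order, the closed subgroup generated by all factors
but one is maximal. -/
theorem IsInternalCartesianProduct.isCoatom {ι : Type*} {a : ι → P}
    (h : IsInternalCartesianProduct fun i => zpowers (a i)) (ha : ∀ i, (orderOf (a i)).Prime)
    (i : ι) : IsCoatom (⨆ j, ⨆ _ : j ≠ i, zpowers (a j)).topologicalClosure := by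
  set N := (⨆ j, ⨆ _ : j ≠ i, zpowers (a j)).topologicalClosure with hN
  have hle : ∀ j k, j ≠ k → zpowers (a j) ≤ (⨆ j, ⨆ _ : j ≠ k, zpowers (a j)).topologicalClosure :=
    fun j k hjk => (le_iSup₂ (f := fun j (_ : j ≠ k) => zpowers (a j)) j hjk).trans
      (le_topologicalClosure _)
  have hnot : a i ∉ N := fun hi => by
    have : a i ∈ (⊥ : Subgroup P) := h.iInf_eq_bot ▸ mem_iInf.2 fun k => by
      rcases eq_or_ne i k with rfl | hik
      · exact hi
      · exact hle i k hik (mem_zpowers _)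
    exact (ha i).ne_one (orderOf_eq_one_iff.2 (mem_bot.1 this))
  have hnormal : (zpowers (a i)).Normal := h.normal i
  have hsup : zpowers (a i) ⊔ N = ⊤ := by
    rw [← top_le_iff, ← h.topologicalClosure_eq_top]
    refine topologicalClosure_minimal _ (iSup_le fun j => ?_) ?_
    · rcases eq_or_ne j i with rfl | hj
      · exact le_sup_left
      · exact (hle j i hj).trans le_sup_right
    · rw [normal_mul]
      exact ((h.isClosed i).isCompact.mul (isClosed_topologicalClosure _).isCompact).isClosed
  refine ⟨fun htop => hnot (htop ▸ mem_top _), fun L hL => ?_⟩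
  obtain ⟨x, hxL, hxN⟩ := SetLike.exists_of_lt hL
  obtain ⟨y, hy, z, hz, rfl⟩ := mem_sup_of_normal_left.1 (hsup.symm ▸ mem_top x)
  have hyL : y ∈ L := (mul_mem_cancel_right (hL.le hz)).1 hxL
  have hy1 : y ≠ 1 := fun h1 => hxN (by rwa [h1, one_mul])
  exact top_le_iff.1 (hsup ▸ sup_le (zpowers_le_of_mem_of_ne_one (ha i) hy hy1 hyL) hL.le)

end CartesianProduct

/-! ### Maximal subgroups of profinite-`C` groups -/

namespace IsProfiniteC

variable {G : Type*} [Group G] [TopologicalSpace G]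

theorem subgroup (h : IsProfiniteC G) {L : Subgroup G} (hL : IsClosed (L : Set G)) :
    IsProfiniteC L := fun H hH => by
  obtain ⟨K, hKc, hK⟩ := h (H.map L.subtype) (hL.isClosedEmbedding_subtypeVal.isClosedMap _ hH)
  exact ⟨K.subgroupOf L, hKc.preimage continuous_subtype_val, hK.subgroupOf_right⟩

variable [IsTopologicalGroup G]

theorem quotient (h : IsProfiniteC G) {N : Subgroup G} [N.Normal] (hN : IsOpen (N : Set G)) :
    IsComplementedGroup (G ⧸ N) := fun H => by
  have hle : N ≤ H.comap (QuotientGroup.mk' N) := by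
    simpa using ker_le_comap (QuotientGroup.mk' N) H
  obtain ⟨K, -, hK⟩ := h (H.comap (QuotientGroup.mk' N))
    (isClosed_of_isOpen _ (isOpen_mono hle hN))
  exact ⟨K.map (QuotientGroup.mk' N), hK.map_of_comap (QuotientGroup.mk'_surjective N)⟩

/-- In a profinite-`C` group every open maximal subgroup `M` has prime index `p`, and the closed
derived subgroup meets the normal core of `M` in a subgroup of index `1` or `p`: this can be read
off from the finite primitive quotient by the normal core. -/
theorem index_prime_and_relIndex_dvd [CompactSpace G] (h : IsProfiniteC G) {M : Subgroup G}
    (hM : IsCoatom M) (hcore : IsOpen (M.normalCore : Set G)) :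
    M.index.Prime ∧ M.normalCore.relIndex (commutator G).topologicalClosure ∣ M.index := by
  have hker : (QuotientGroup.mk' M.normalCore).ker = M.normalCore := QuotientGroup.ker_mk' _
  have hfin : Finite (G ⧸ M.normalCore) := quotient_finite_of_isOpen _ hcore
  obtain ⟨V, hV, hprime, hle⟩ := (h.quotient hcore).exists_card_eq_index hM
    (QuotientGroup.mk'_surjective _) hker
  refine ⟨hprime, ?_⟩
  have hle' : (commutator G).topologicalClosure ≤ V.comap (QuotientGroup.mk' M.normalCore) :=
    topologicalClosure_minimal _ hle (isClosed_of_isOpen _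
      (isOpen_mono (hker.ge.trans (ker_le_comap _ V)) hcore))
  calc M.normalCore.relIndex (commutator G).topologicalClosure
      = (comap (QuotientGroup.mk' M.normalCore) ⊥).relIndex (commutator G).topologicalClosure :=
        congrArg (fun N => relIndex N (commutator G).topologicalClosure) hker.symm
    _ = Nat.card (map (QuotientGroup.mk' M.normalCore) (commutator G).topologicalClosure) := by
        rw [relIndex_comap, relIndex_bot_left]
    _ ∣ Nat.card V := card_dvd_of_le (map_le_iff_le_comap.2 hle')
    _ = M.index := hV

variable [CompactSpace G] [TotallyDisconnectedSpace G] [T1Space G]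

/-- The Frattini subgroups of the finite quotients are trivial, so the open maximal subgroups
intersect trivially. -/
theorem exists_isCoatom_notMem (h : IsProfiniteC G) {x : G} (hx : x ≠ 1) :
    ∃ M : Subgroup G, IsCoatom M ∧ IsOpen (M.normalCore : Set G) ∧ x ∉ M := by
  obtain ⟨U, hU⟩ := ProfiniteGrp.exist_openNormalSubgroup_sub_open_nhds_of_one
    (isOpen_compl_singleton (x := x)) (by simpa using hx.symm)
  have hUo : IsOpen (U.toSubgroup : Set G) := U.isOpen'
  have hxU : x ∉ U.toSubgroup := fun hxU => hU hxU rfl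
  have hUn : U.toSubgroup.Normal := U.isNormal'
  set f := QuotientGroup.mk' U.toSubgroup with hf
  have hfs : Function.Surjective f := QuotientGroup.mk'_surjective _
  have hfin : Finite (G ⧸ U.toSubgroup) := quotient_finite_of_isOpen _ hUo
  have hfx : f x ∉ frattini (G ⧸ U.toSubgroup) := by
    rw [(h.quotient hUo).frattini_eq_bot, mem_bot]
    exact fun h1 => hxU ((QuotientGroup.eq_one_iff x).1 h1)
  obtain ⟨M, hM, hxM⟩ : ∃ M : Subgroup (G ⧸ U.toSubgroup), IsCoatom M ∧ f x ∉ M := by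
    by_contra! hall
    refine hfx ?_
    rw [frattini, Order.radical]
    simpa [mem_iInf] using hall
  have hle : U.toSubgroup ≤ M.comap f := by simpa [hf] using ker_le_comap f M
  exact ⟨M.comap f, isCoatom_comap_of_surjective hfs hM,
    isOpen_mono (normal_le_normalCore.2 hle) hUo, hxM⟩

end IsProfiniteC

/-! ### Subgroups of a normal subgroup that are normal in the whole group -/

/-- The subgroups of a normal subgroup `A` of `G` that are normal in `G`. -/
def normalSubgroupsOf {G : Type*} [Group G] (A : Subgroup G) [A.Normal] : Set (Subgroup A) :=
  {K | ∀ g : G, K ≤ K.comap (MulAut.conjNormal g : MulAut A).toMonoidHom}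

section NormalSubgroupsOf

variable {G : Type*} [Group G] {A : Subgroup G} [A.Normal]

theorem mem_normalSubgroupsOf_iff {K : Subgroup A} :
    K ∈ normalSubgroupsOf A ↔ (K.map A.subtype).Normal := by
  constructor
  · refine fun h => ⟨?_⟩
    rintro _ ⟨x, hx, rfl⟩ g
    exact ⟨_, h g hx, MulAut.conjNormal_apply g x⟩
  · intro h g x hx
    obtain ⟨y, hy, hyx⟩ := h.conj_mem x (mem_map_of_mem _ hx) g
    have : y = MulAut.conjNormal g x := Subtype.ext (hyx.trans (MulAut.conjNormal_apply g x).symm)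
    rw [this] at hy
    exact hy

theorem sInf_mem_normalSubgroupsOf {S : Set (Subgroup A)} (hS : S ⊆ normalSubgroupsOf A) :
    sInf S ∈ normalSubgroupsOf A := fun g _ hx =>
  mem_sInf.2 fun K hK => hS hK g (mem_sInf.1 hx K hK)

theorem iSup_mem_normalSubgroupsOf {ι : Sort*} {K : ι → Subgroup A}
    (hK : ∀ i, K i ∈ normalSubgroupsOf A) : ⨆ i, K i ∈ normalSubgroupsOf A := fun g =>
  iSup_le fun i => (hK i g).trans (comap_mono (le_iSup K i))

theorem normal_of_mem_normalSubgroupsOf {K : Subgroup A} (hK : K ∈ normalSubgroupsOf A) :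
    K.Normal :=
  ⟨fun x hx a => by
    have : MulAut.conjNormal (a : G) x = a * x * a⁻¹ := Subtype.ext (by simp)
    exact this ▸ hK a hx⟩

theorem topologicalClosure_mem_normalSubgroupsOf [TopologicalSpace G] [IsTopologicalGroup G]
    {K : Subgroup A} (hK : K ∈ normalSubgroupsOf A) :
    K.topologicalClosure ∈ normalSubgroupsOf A := fun g => by
  refine topologicalClosure_minimal _ ((hK g).trans (comap_mono K.le_topologicalClosure)) ?_
  refine IsClosed.preimage (Continuous.subtype_mk (f := fun x : A => g * x * g⁻¹) ?_ _)
    K.isClosed_topologicalClosure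
  fun_prop

end NormalSubgroupsOf

/-! ### The equivalence -/

section Decomposition

universe u

variable {G : Type u} [Group G] [TopologicalSpace G] [IsTopologicalGroup G] [CompactSpace G]
  [T2Space G]

/-- Given a closed subgroup `H`, let `C` be a complement of `A ∩ H` in `A` that is normal in `G`,
and let `B₁` be a complement of `B ∩ AH` in `B`. Then `C B₁` is a complement of `H`. -/
theorem IsPrimeCyclicDecomposition.isProfiniteC {B A : Subgroup G}
    (h : IsPrimeCyclicDecomposition B A) : IsProfiniteC G := fun H hH => by
  obtain ⟨J, b, hb, hbprod⟩ := h.left_eq_prod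
  obtain ⟨I, a, ha, hanormal, haprod⟩ := h.right_eq_prod
  have hAn : A.Normal := h.normal_right
  have hcA : CompactSpace A := isCompact_iff_compactSpace.1 h.isClosed_right.isCompact
  have hcB : CompactSpace B := isCompact_iff_compactSpace.1 h.isClosed_left.isCompact
  have hBnormal : ∀ j, (zpowers (b j)).Normal := hbprod.normal
  have hAH : IsClosed ((A ⊔ H : Subgroup G) : Set G) := by
    rw [normal_mul]
    exact (h.isClosed_right.isCompact.mul hH.isCompact).isClosed
  have haQ : ∀ i, zpowers (a i) ∈ normalSubgroupsOf A := fun i => by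
    rw [mem_normalSubgroupsOf_iff, MonoidHom.map_zpowers]
    exact hanormal i
  have hNQ : ∀ i, (⨆ j, ⨆ _ : j ≠ i, zpowers (a j)).topologicalClosure ∈ normalSubgroupsOf A :=
    fun i => topologicalClosure_mem_normalSubgroupsOf
      (iSup_mem_normalSubgroupsOf fun j => iSup_mem_normalSubgroupsOf fun _ => haQ j)
  obtain ⟨C, hCQ, hCc, hC⟩ := exists_isComplement'_of_coatoms
    (fun S hS => sInf_mem_normalSubgroupsOf hS) hNQ (fun i => isClosed_topologicalClosure _)
    (fun i => normal_of_mem_normalSubgroupsOf (hNQ i)) (haprod.isCoatom ha) haprod.iInf_eq_bot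
    (D := H.subgroupOf A) (hH.preimage continuous_subtype_val)
  obtain ⟨B₁, -, hB₁c, hB₁⟩ := exists_isComplement'_of_coatoms (Q := Set.univ)
    (fun S hS => Set.mem_univ _) (fun i => Set.mem_univ _)
    (fun i => isClosed_topologicalClosure _)
    (fun i => is_normal_topologicalClosure _) (hbprod.isCoatom hb) hbprod.iInf_eq_bot
    (D := (A ⊔ H).subgroupOf B) (hAH.preimage continuous_subtype_val)
  have hCn : (C.map A.subtype).Normal := mem_normalSubgroupsOf_iff.1 hCQ
  rw [isComplement'_iff_disjoint_and_exists, disjoint_def] at hC hB₁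
  have hBA := h.isComplement'.symm
  rw [isComplement'_iff_disjoint_and_exists, disjoint_def] at hBA
  refine ⟨C.map A.subtype ⊔ B₁.map B.subtype, ?_,
    isComplement'_iff_disjoint_and_exists.2 ⟨disjoint_def.2 ?_, fun x => ?_⟩⟩
  · rw [normal_mul]
    exact ((hCc.isCompact.image continuous_subtype_val).mul
      (hB₁c.isCompact.image continuous_subtype_val)).isClosed
  · intro x hxH hx
    obtain ⟨_, ⟨c, hc, rfl⟩, _, ⟨y, hy, rfl⟩, rfl⟩ := mem_sup_of_normal_left.1 hx
    have hyAH : (y : G) ∈ A ⊔ H := (mul_mem_cancel_left (mem_sup_left c.2)).1 (mem_sup_right hxH)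
    have hy1 : y = 1 := hB₁.1 (mem_subgroupOf.2 hyAH) hy
    subst hy1
    have hc1 : c = 1 := hC.1 (mem_subgroupOf.2 (by simpa using hxH)) hc
    simp [hc1]
  · -- `G = AB = A (B ∩ HA) B₁ = H A B₁ = H C B₁`
    obtain ⟨y, hy, hyx⟩ := hBA.2 x
    obtain ⟨z, hz, hzx⟩ := hB₁.2 ⟨y⁻¹ * x, hyx⟩
    have hyz : y * z ∈ H ⊔ A := sup_comm A H ▸ mul_mem (mem_sup_left hy) (mem_subgroupOf.1 hz)
    obtain ⟨k, hk, w, hw, hkw⟩ := mem_sup_of_normal_right.1 hyz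
    obtain ⟨l, hl, hlw⟩ := hC.2 ⟨w, hw⟩
    refine ⟨k * l, H.mul_mem hk (mem_subgroupOf.1 hl), ?_⟩
    have hx : (k * l)⁻¹ * x = (l⁻¹ * w) * (z⁻¹ * (y⁻¹ * x)) := by
      rw [eq_inv_mul_of_mul_eq hkw]
      simp only [Subgroup.coe_inv, mul_inv_rev, mul_assoc, mul_inv_cancel_left]
    rw [hx]
    exact mul_mem (mem_sup_left (mem_map_of_mem A.subtype hlw))
      (mem_sup_right (mem_map_of_mem B.subtype hzx))

theorem IsProfiniteC.exists_isPrimeCyclicDecomposition [TotallyDisconnectedSpace G]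
    (h : IsProfiniteC G) :
    ∃ B : Subgroup G, IsPrimeCyclicDecomposition B (commutator G).topologicalClosure := by
  set A := (commutator G).topologicalClosure with hA
  have hAc : IsClosed (A : Set G) := isClosed_topologicalClosure _
  have hAn : A.Normal := is_normal_topologicalClosure _
  obtain ⟨B, hBc, hB⟩ := h A hAc
  have hcA : CompactSpace A := isCompact_iff_compactSpace.1 hAc.isCompact
  have hcB : CompactSpace B := isCompact_iff_compactSpace.1 hBc.isCompact
  have hBcomm : ∀ x y : B, x * y = y * x := fun x y => by
    refine commutatorElement_eq_one_iff_mul_comm.1 (Subtype.ext ?_)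
    refine disjoint_def.1 hB.disjoint ?_ (⁅x, y⁆ : B).2
    exact le_topologicalClosure _ (commutator_mem_commutator (mem_top (x : G)) (mem_top (y : G)))
  have hBn : ∀ K : Subgroup B, K.Normal := fun K =>
    ⟨fun x hx g => by rwa [hBcomm g x, mul_inv_cancel_right]⟩
  refine ⟨B, hBc, hAc, hAn, hB.symm, ?_, ?_⟩
  · obtain ⟨J, b, hb, -, hprod⟩ := exists_isInternalCartesianProduct (P := B) (Q := Set.univ)
      (fun S hS => Set.mem_univ _) (fun K _ => hBn K) fun x hx => by
        have hBC := h.subgroup hBc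
        obtain ⟨M, hM, hMo, hxM⟩ := hBC.exists_isCoatom_notMem (x := x) hx
        exact ⟨M, Set.mem_univ _, isOpen_mono (normalCore_le M) hMo,
          (hBC.index_prime_and_relIndex_dvd hM hMo).1, hxM⟩
    exact ⟨J, b, hb, hprod⟩
  · obtain ⟨I, a, ha, haQ, hprod⟩ := exists_isInternalCartesianProduct (P := A)
      (fun S hS => sInf_mem_normalSubgroupsOf hS) (fun K => normal_of_mem_normalSubgroupsOf)
      fun x hx => by
        obtain ⟨M, hM, hMo, hxM⟩ := h.exists_isCoatom_notMem
          (x := (x : G)) fun h1 => hx (Subtype.ext h1)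
        obtain ⟨hp, hdvd⟩ := h.index_prime_and_relIndex_dvd hM hMo
        have hxN : (x : G) ∉ M.normalCore := fun hxN => hxM (normalCore_le M hxN)
        refine ⟨M.normalCore.subgroupOf A, ?_, hMo.preimage continuous_subtype_val, ?_, hxN⟩
        · rw [mem_normalSubgroupsOf_iff, subgroupOf_map_subtype]
          infer_instance
        · rcases (Nat.dvd_prime hp).1 hdvd with h1 | h1
          · exact absurd (relIndex_eq_one.1 h1 x.2) hxN
          · exact (congrArg Nat.Prime h1).mpr hp
    refine ⟨I, a, ha, fun i => ?_, hprod⟩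
    have := mem_normalSubgroupsOf_iff.1 (haQ i)
    rwa [MonoidHom.map_zpowers] at this

end Decomposition

end

theorem theoremB {G : Type*} [Group G] [TopologicalSpace G] [IsTopologicalGroup G]
    [CompactSpace G] [T2Space G] [TotallyDisconnectedSpace G] :
    (IsProfiniteC G ↔ ∃ B A : Subgroup G, IsPrimeCyclicDecomposition B A) ∧
    (IsProfiniteC G →
      ∃ B : Subgroup G, IsPrimeCyclicDecomposition B (commutator G).topologicalClosure) :=
  ⟨⟨fun h => h.exists_isPrimeCyclicDecomposition.imp fun _ hB => ⟨_, hB⟩,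
    fun ⟨_, _, h⟩ => h.isProfiniteC⟩, fun h => h.exists_isPrimeCyclicDecomposition⟩
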